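/- A link projection is a nonempty finite system of closed curves on $S^2$ whose only (self-)intersections are finitely many transverse double points, called crossings; it may be split, it may have components without crossings, and it is considered up to isotopy of $S^2$. The connected components of its complement are its regions. A set of regions is isolated if no two distinct regions in it share a crossing on their boundaries, and the isolate-region number $I(L)$ of a link projection $L$ is the maximal cardinality of an isolated set of regions. Let $I'(L)$ be the number defined in the same way, except that two regions also count as connected (and so cannot both belong to an isolated set) if their boundaries share a component of $L$ without crossings; thus $I'(L)=I(L)$ if every component of $L$ passes through a crossing. For $n\ge 1$ let $T(2,n)$ denote the standard projection with $n$ crossings of the $(2,n)$-torus link, i.e. the closure of the 2-braid with $n$ crossings. Theorem. Let $L$ be a link projection. (a) $I'(L)=1$ if and only if $L$ is one of the following four projections: the trivial circle (a simple closed curve), the curve $T(2,1)$ with one crossing, the two-crossing projection $T(2,2)$ of the Hopf link, and the standard three-crossing projection $T(2,3)$ of the trefoil. (b) $I(L)=1$ if and only if $L$ is one of $T(2,1)$, $T(2,2)$, $T(2,3)$. -/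

import Mathlib

open Sum

/-- A finite system of closed curves with transverse double points on a closed oriented surface,
all of whose regions are planar (spheres with holes), up to orientation preserving homeomorphism.

* `Crossing` is the set of double points. Four half-edges leave each crossing `c`; they are
  `(c, 0), (c, 1), (c, 2), (c, 3)` in counterclockwise order, so that the two branches of the curve
  through `c` are `(c, 0), (c, 2)` and `(c, 1), (c, 3)`.
* `opp` sends a half-edge to the other half of the same edge.
* `Circle` is the set of the curves that run through no crossing.
* The pair `(c, i)` also names the corner at `c` between the half-edges `(c, i)` and `(c, i + 1)`,
  which lies on the left of somebody who leaves `c` along `(c, i)`; the corner `(c, i - 1)` lies on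
  the right. A curve `o` without crossings has the two sides `(o, true)` and `(o, false)`.
* A region of the complement is a class of corners and sides. Corners on the same side of an edge
  lie in one region; a region that has several boundary curves is a union of several boundary
  cycles (this is where the mutual position of the parts of a split system is recorded). -/
structure CurveSystem where
  Crossing : Type
  Circle : Type
  finite_crossing : Finite Crossing
  finite_circle : Finite Circle
  nonempty : Nonempty (Crossing ⊕ Circle)
  opp : Crossing × ZMod 4 → Crossing × ZMod 4
  opp_opp : ∀ h, opp (opp h) = h
  opp_ne : ∀ h, opp h ≠ h
  sameRegion : Setoid ((Crossing × ZMod 4) ⊕ (Circle × Bool))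
  /-- What is on the left when an edge is left through `h` is on the right when it is run through
  from the other end. -/
  sameRegion_opp : ∀ h, sameRegion.r (inl h) (inl ((opp h).1, (opp h).2 - 1))

namespace CurveSystem

variable (L : CurveSystem)

/-- The regions: the connected pieces into which the surface is divided by the curves. -/
def Region : Type := Quotient L.sameRegion

/-- The region that contains the corner `h`, i.e. the one on the left of the half-edge `h`. -/
def left (h : L.Crossing × ZMod 4) : L.Region := Quotient.mk L.sameRegion (inl h)

/-- The region on the right of the half-edge `h`. -/
def right (h : L.Crossing × ZMod 4) : L.Region := L.left (h.1, h.2 - 1)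

/-- The regions on the two sides of a curve without crossings. -/
def side (s : L.Circle × Bool) : L.Region := Quotient.mk L.sameRegion (inr s)

/-- Two regions that lie on the two sides of an edge or of a curve without crossings. -/
inductive Adjacent : L.Region → L.Region → Prop
  | edge (h : L.Crossing × ZMod 4) : Adjacent (L.left h) (L.right h)
  | circle (o : L.Circle) : Adjacent (L.side (o, true)) (L.side (o, false))

/-- The surface is connected: one gets from any region to any other by crossing edges. -/
def SurfaceConnected : Prop := ∀ r s : L.Region, Relation.EqvGen L.Adjacent r s

/-- Every closed curve carried by the system separates the surface: if a set of edges (`z`) and of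
curves without crossings (`y`) has even degree at every crossing, then there is a set `f` of regions
such that an edge or a curve is chosen exactly when one of its two sides belongs to `f` and the
other does not. In homological terms: every cycle modulo 2 is a boundary. Among
the closed connected surfaces that are cut into planar regions, the 2-sphere is the only one with
this property. -/
def CurvesSeparate : Prop :=
  ∀ (z : L.Crossing × ZMod 4 → ZMod 2) (y : L.Circle → ZMod 2),
    (∀ h, z (L.opp h) = z h) → (∀ c, ∑ i : ZMod 4, z (c, i) = 0) →
    ∃ f : L.Region → ZMod 2, (∀ h, z h = f (L.left h) + f (L.right h)) ∧
      ∀ o, y o = f (L.side (o, true)) + f (L.side (o, false))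

end CurveSystem

/-- A link projection on the 2-sphere: a nonempty finite system of closed curves whose only
intersections are transverse double points, on a surface that is a sphere. It may be split, and
components without crossings are allowed. -/
structure LinkProjection extends CurveSystem where
  surfaceConnected : toCurveSystem.SurfaceConnected
  curvesSeparate : toCurveSystem.CurvesSeparate

namespace LinkProjection

/-- Two link projections are the same when an orientation preserving homeomorphism of the sphere
(equivalently, an isotopy) carries one to the other: there are bijections of the half-edges and of
the sides of the curves without crossings that respect the cyclic order at the crossings, the edges,
the two sides of each curve, and the regions. -/
def Same (L M : LinkProjection) : Prop :=
  ∃ (e : L.Crossing × ZMod 4 ≃ M.Crossing × ZMod 4) (d : L.Circle × Bool ≃ M.Circle × Bool),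
    (∀ c i, e (c, i + 1) = ((e (c, i)).1, (e (c, i)).2 + 1)) ∧
    (∀ h, e (L.opp h) = M.opp (e h)) ∧
    (∀ o b, d (o, !b) = ((d (o, b)).1, !(d (o, b)).2)) ∧
    ∀ s t, L.sameRegion.r s t ↔ M.sameRegion.r (Sum.map e d s) (Sum.map e d t)

section

variable (L : LinkProjection)

/-- The two regions share a crossing on their boundaries. -/
def ShareCrossing (r s : L.Region) : Prop :=
  ∃ (c : L.Crossing) (i j : ZMod 4), r = L.left (c, i) ∧ s = L.left (c, j)

/-- The two regions share, on their boundaries, a crossing or a component without crossings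
(that is, their boundaries meet). -/
def BoundariesMeet (r s : L.Region) : Prop :=
  L.ShareCrossing r s ∨ ∃ (o : L.Circle) (a b : Bool), r = L.side (o, a) ∧ s = L.side (o, b)

/-- The maximal cardinality of a set of regions any two (distinct) of which are not related by
`conn`. -/
noncomputable def isolationNumber (conn : L.Region → L.Region → Prop) : ℕ :=
  sSup {k | ∃ W : Finset L.Region, (W : Set L.Region).Pairwise (fun r s => ¬ conn r s) ∧
    W.card = k}

/-- The isolate-region number: the maximal cardinality of a set of regions any two of which share
no crossing. -/
noncomputable def isolateRegionNumber : ℕ := L.isolationNumber L.ShareCrossing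

/-- The isolate-region number with the convention that the two regions along a component without
crossings also count as connected. -/
noncomputable def isolateRegionNumber' : ℕ := L.isolationNumber L.BoundariesMeet

theorem finite_region : Finite L.Region := by
  have := L.finite_crossing
  have := L.finite_circle
  unfold CurveSystem.Region
  infer_instance

/-- The supremum in the definition is a maximum. -/
theorem isGreatest_isolationNumber (conn : L.Region → L.Region → Prop) :
    IsGreatest {k | ∃ W : Finset L.Region,
      (W : Set L.Region).Pairwise (fun r s => ¬ conn r s) ∧ W.card = k}
      (L.isolationNumber conn) := by
  have := L.finite_region
  have := Fintype.ofFinite L.Region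
  have hb : BddAbove {k | ∃ W : Finset L.Region,
      (W : Set L.Region).Pairwise (fun r s => ¬ conn r s) ∧ W.card = k} :=
    ⟨Fintype.card L.Region, by rintro k ⟨W, -, rfl⟩; exact W.card_le_univ⟩
  exact ⟨Nat.sSup_mem ⟨0, ∅, by simp, rfl⟩ hb, fun k hk => le_csSup hb hk⟩

end

/-- One simple closed curve, with one region on either side. -/
def trivialCircleSystem : CurveSystem where
  Crossing := Empty
  Circle := Unit
  finite_crossing := inferInstance
  finite_circle := inferInstance
  nonempty := ⟨inr ()⟩
  opp := id
  opp_opp := fun h => h.1.elim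
  opp_ne := fun h => h.1.elim
  sameRegion := ⊥
  sameRegion_opp := fun h => h.1.elim

/-- The trivial circle. -/
def trivialCircle : LinkProjection where
  toCurveSystem := trivialCircleSystem
  surfaceConnected := by
    intro r s
    have key : Relation.EqvGen trivialCircleSystem.Adjacent
      (trivialCircleSystem.side ((), true)) (trivialCircleSystem.side ((), false)) :=
      .rel _ _ (.circle (L := trivialCircleSystem) ())
    induction r using Quotient.inductionOn with | _ r => ?_
    induction s using Quotient.inductionOn with | _ s => ?_
    rcases r with ⟨⟨⟩, -⟩ | ⟨⟨⟩, a⟩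
    rcases s with ⟨⟨⟩, -⟩ | ⟨⟨⟩, b⟩
    cases a <;> cases b
    · exact .refl _
    · exact .symm _ _ key
    · exact key
    · exact .refl _
  curvesSeparate := by
    intro z y _ _
    refine ⟨Quotient.lift (Sum.elim (fun _ => 0) (fun s => if s.2 then y () else 0)) ?_,
      fun h => h.1.elim, ?_⟩
    · intro a b h
      have : a = b := h
      rw [this]
    · rintro ⟨⟩
      simp [CurveSystem.side]

/-- The region of the standard projection of the (2,n)-torus link that contains a given corner:
`inl true` and `inl false` are the left and the right outer regions, `inr c` is the one between
the crossings `c` and `c + 1`. -/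
def torusLabel (n : ℕ) : (ZMod n × ZMod 4) ⊕ (Empty × Bool) → Bool ⊕ ZMod n
  | inl (c, i) => if i = 0 then inr c else if i = 1 then inl true
      else if i = 2 then inr (c - 1) else inl false
  | inr s => s.1.elim

/-- The joining of half-edges in the closure of the 2-braid with `n` crossings. -/
def torusOpp (n : ℕ) (h : ZMod n × ZMod 4) : ZMod n × ZMod 4 :=
  if h.2 = 0 ∨ h.2 = 1 then (h.1 + 1, 3 - h.2) else (h.1 - 1, 3 - h.2)

theorem zmod4_cases (i : ZMod 4) : i = 0 ∨ i = 1 ∨ i = 2 ∨ i = 3 := by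
  revert i; decide

theorem torusLabel_zero (n : ℕ) (c : ZMod n) : torusLabel n (inl (c, 0)) = inr c := rfl

theorem torusLabel_one (n : ℕ) (c : ZMod n) : torusLabel n (inl (c, 1)) = inl true := rfl

theorem torusLabel_two (n : ℕ) (c : ZMod n) : torusLabel n (inl (c, 2)) = inr (c - 1) := rfl

theorem torusLabel_three (n : ℕ) (c : ZMod n) : torusLabel n (inl (c, 3)) = inl false := rfl

theorem torusOpp_zero (n : ℕ) (c : ZMod n) : torusOpp n (c, 0) = (c + 1, 3) := rfl

theorem torusOpp_one (n : ℕ) (c : ZMod n) : torusOpp n (c, 1) = (c + 1, 2) := rfl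

theorem torusOpp_two (n : ℕ) (c : ZMod n) : torusOpp n (c, 2) = (c - 1, 1) := rfl

theorem torusOpp_three (n : ℕ) (c : ZMod n) : torusOpp n (c, 3) = (c - 1, 0) := rfl

/-- The closure of the 2-braid with `n` crossings one above the other. The half-edges `0, 1, 2, 3`
of a crossing point to the upper right, upper left, lower left and lower right; the upper ones are
joined to the lower ones of the next crossing on the same side (after the last crossing comes the
first). The regions are the two outer ones and the `n` regions between successive crossings. -/
def torusSystem (n : ℕ) [NeZero n] : CurveSystem where
  Crossing := ZMod n
  Circle := Empty
  finite_crossing := inferInstance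
  finite_circle := inferInstance
  nonempty := ⟨inl 0⟩
  opp := torusOpp n
  opp_opp := by
    rintro ⟨c, i⟩
    rcases zmod4_cases i with rfl | rfl | rfl | rfl <;>
      simp [torusOpp_zero, torusOpp_one, torusOpp_two, torusOpp_three]
  opp_ne := by
    rintro ⟨c, i⟩ h
    have h2 := congrArg Prod.snd h
    rcases zmod4_cases i with rfl | rfl | rfl | rfl <;> revert h2 <;>
      simp only [torusOpp_zero, torusOpp_one, torusOpp_two, torusOpp_three] <;> decide
  sameRegion := Setoid.ker (torusLabel n)
  sameRegion_opp := by
    rintro ⟨c, i⟩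
    change torusLabel n _ = torusLabel n _
    rcases zmod4_cases i with rfl | rfl | rfl | rfl
    · rw [torusOpp_zero, torusLabel_zero]
      exact (congrArg inr (add_sub_cancel_right c 1)).symm
    · rfl
    · rfl
    · rfl

/-- The standard projection of the (2,n)-torus link: the closure of the 2-braid with `n` crossings.
For `n = 1` it is the curve with one crossing, for `n = 2` the projection of the Hopf link with two
crossings, for `n = 3` the projection of the trefoil with three crossings. -/
def torus (n : ℕ) [NeZero n] : LinkProjection where
  toCurveSystem := torusSystem n
  surfaceConnected := by
    have ha (c : ZMod n) : (torusSystem n).left (c, (3 : ZMod 4)) =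
        (torusSystem n).left ((0 : ZMod n), (3 : ZMod 4)) := Quotient.sound rfl
    have hb (c : ZMod n) : Relation.EqvGen (torusSystem n).Adjacent
        ((torusSystem n).left (c, (0 : ZMod 4)))
        ((torusSystem n).left ((0 : ZMod n), (3 : ZMod 4))) := by
      rw [← ha c]
      exact .rel _ _ (CurveSystem.Adjacent.edge (L := torusSystem n) (c, (0 : ZMod 4)))
    have hl (c : ZMod n) : Relation.EqvGen (torusSystem n).Adjacent
        ((torusSystem n).left (c, (1 : ZMod 4)))
        ((torusSystem n).left ((0 : ZMod n), (3 : ZMod 4))) :=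
      .trans _ _ _ (.rel _ _
        (CurveSystem.Adjacent.edge (L := torusSystem n) (c, (1 : ZMod 4)))) (hb c)
    have hd (c : ZMod n) : (torusSystem n).left (c, (2 : ZMod 4)) =
        (torusSystem n).left (c - 1, (0 : ZMod 4)) := Quotient.sound rfl
    have key (r : (torusSystem n).Region) : Relation.EqvGen (torusSystem n).Adjacent r
        ((torusSystem n).left ((0 : ZMod n), (3 : ZMod 4))) := by
      induction r using Quotient.inductionOn with | _ r => ?_
      rcases r with ⟨c, i⟩ | ⟨⟨⟩, -⟩
      change Relation.EqvGen _ ((torusSystem n).left (c, i)) _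
      rcases zmod4_cases i with rfl | rfl | rfl | rfl
      · exact hb c
      · exact hl c
      · rw [hd c]
        exact hb _
      · rw [ha c]
        exact .refl _
    intro r s
    exact .trans _ _ _ (key r) (.symm _ _ (key s))
  curvesSeparate := by
    intro (z : ZMod n × ZMod 4 → ZMod 2) y hz hc
    have h3 (c : ZMod n) : z (c + 1, (3 : ZMod 4)) = z (c, (0 : ZMod 4)) := hz (c, (0 : ZMod 4))
    have h2 (c : ZMod n) : z (c + 1, (2 : ZMod 4)) = z (c, (1 : ZMod 4)) := hz (c, (1 : ZMod 4))
    have hs (c : ZMod n) : z (c + 1, (0 : ZMod 4)) + z (c + 1, (1 : ZMod 4)) =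
        z (c, (0 : ZMod 4)) + z (c, (1 : ZMod 4)) := by
      have h := hc (c + 1)
      have h4 : ∑ i : ZMod 4, z (c + 1, i) = z (c + 1, (0 : ZMod 4)) + z (c + 1, (1 : ZMod 4)) +
        z (c + 1, (2 : ZMod 4)) + z (c + 1, (3 : ZMod 4)) := Fin.sum_univ_four _
      replace h := h4.symm.trans h
      rw [h2, h3] at h
      clear h4
      generalize z (c + 1, (0 : ZMod 4)) = a at *
      generalize z (c + 1, (1 : ZMod 4)) = b at *
      generalize z (c, (0 : ZMod 4)) = a' at *
      generalize z (c, (1 : ZMod 4)) = b' at *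
      revert a b a' b'
      decide
    have hk (k : ℕ) : z ((k : ZMod n), (0 : ZMod 4)) + z ((k : ZMod n), (1 : ZMod 4)) =
        z ((0 : ZMod n), (0 : ZMod 4)) + z ((0 : ZMod n), (1 : ZMod 4)) := by
      induction k with
      | zero => simp
      | succ k ih => rw [Nat.cast_succ, hs (k : ZMod n), ih]
    have hall (c : ZMod n) : z (c, (0 : ZMod 4)) + z (c, (1 : ZMod 4)) =
        z ((0 : ZMod n), (0 : ZMod 4)) + z ((0 : ZMod n), (1 : ZMod 4)) := by
      have := hk c.val
      rwa [ZMod.natCast_zmod_val] at this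
    let g : Bool ⊕ ZMod n → ZMod 2 := Sum.elim
      (fun b => if b then z ((0 : ZMod n), (0 : ZMod 4)) + z ((0 : ZMod n), (1 : ZMod 4)) else 0)
      (fun c => z (c, (0 : ZMod 4)))
    refine ⟨Quotient.lift (fun s => g (torusLabel n s)) fun a b h => congrArg g h, ?_,
      fun o => o.elim⟩
    have e0 (c : ZMod n) : z (c, (0 : ZMod 4)) = z (c, (0 : ZMod 4)) + 0 := (add_zero _).symm
    have e1 (c : ZMod n) : z (c, (1 : ZMod 4)) =
        (z ((0 : ZMod n), (0 : ZMod 4)) + z ((0 : ZMod n), (1 : ZMod 4))) +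
          z (c, (0 : ZMod 4)) := by
      rw [← hall c]
      generalize z (c, (0 : ZMod 4)) = a
      generalize z (c, (1 : ZMod 4)) = b
      revert a b
      decide
    rintro ⟨c, i⟩
    change ZMod n at c
    rcases zmod4_cases i with rfl | rfl | rfl | rfl
    · exact e0 c
    · exact e1 c
    · have h : z (c, (2 : ZMod 4)) = z (c - 1, (1 : ZMod 4)) := (hz (c, (2 : ZMod 4))).symm
      exact h.trans ((e1 _).trans (add_comm _ _))
    · have h : z (c, (3 : ZMod 4)) = z (c - 1, (0 : ZMod 4)) := (hz (c, (3 : ZMod 4))).symm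
      exact h.trans ((e0 _).trans (add_comm _ _))

end LinkProjection

/-!
All regions are pairwise connected exactly when the isolation number is 1
(`isolationNumber_eq_one_iff`), so the theorem classifies the projections whose regions meet
pairwise. The classification is a count on a checkerboard colouring.

Let there be `n` crossings, `o` curves without crossings, `b` black and `w` white regions. At a
crossing only one pair of black and one pair of white corners are opposite to each other, and two
regions of different colours can only meet along an edge or a curve without crossings. If
all regions meet, then `b (b - 1) ≤ 2 n`, `w (w - 1) ≤ 2 n` and `b w ≤ 2 n + o`. On the other hand
`n + o + 2 ≤ b + w` for `n > 0` (`euler_inequality`): the space of cycles modulo 2 carried by the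
curves has dimension at least `n + o + 1`, and on the sphere all of them bound. Together the bounds
leave, up to exchanging the colours, `n ≤ 3`, `o = 0`, `b = n`, `w = 2`, besides the single curve
with `n = 0`, `o = 1` (`census_arith`).

For `n > 0` the bound `b w ≤ 2 n` is then attained, so that each half-edge is determined by the
regions on its left and on its right (`IsCheckerboard.halfEdge_injective`). This makes the two white
corners of each crossing belong to the two different white regions
(`IsCheckerboard.white_corners_ne`), and going from one black corner of a crossing to the opposite
one is a permutation of the `n ≤ 3` black regions. It relates any two of them, so it is a cycle,
and numbering the crossings along this cycle identifies the projection with `torus n`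
(`IsCheckerboard.same_torus`).
-/

namespace LinkProjection

/-! ### Regions and isolation number one -/

section

variable (L : LinkProjection)

theorem left_opp (h : L.Crossing × ZMod 4) : L.left (L.opp h) = L.right h := by
  have := L.sameRegion_opp (L.opp h)
  rw [L.opp_opp] at this
  exact Quotient.sound this

theorem right_opp (h : L.Crossing × ZMod 4) : L.right (L.opp h) = L.left h :=
  (Quotient.sound (L.sameRegion_opp h)).symm

theorem region_cases (r : L.Region) : (∃ h, r = L.left h) ∨ ∃ s, r = L.side s := by
  induction r using Quotient.inductionOn with | _ r => ?_
  rcases r with h | s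
  · exact .inl ⟨h, rfl⟩
  · exact .inr ⟨s, rfl⟩

theorem nonempty_region : Nonempty L.Region := by
  obtain ⟨c | o⟩ := L.nonempty
  · exact ⟨L.left (c, 0)⟩
  · exact ⟨L.side (o, true)⟩

theorem isolationNumber_eq_one_iff {conn : L.Region → L.Region → Prop}
    (hsymm : ∀ r s, conn r s → conn s r) :
    L.isolationNumber conn = 1 ↔ ∀ r s, r ≠ s → conn r s := by
  classical
  obtain ⟨⟨W, hW, hcard⟩, hmax⟩ := L.isGreatest_isolationNumber conn
  constructor
  · intro h1 r s hrs
    by_contra hc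
    have h2 := hmax (a := 2) ⟨{r, s}, ?_, Finset.card_pair hrs⟩
    · omega
    · rw [Finset.coe_pair, Set.pairwise_pair]
      exact fun _ => ⟨hc, fun h => hc (hsymm _ _ h)⟩
  · intro h
    obtain ⟨r⟩ := L.nonempty_region
    have h1 := hmax (a := 1) ⟨{r}, by simp, by simp⟩
    have h2 : W.card ≤ 1 := Finset.card_le_one.2 fun r hr s hs => by
      by_contra hrs
      exact hW hr hs hrs (h r s hrs)
    omega

theorem shareCrossing_symm (r s : L.Region) (h : L.ShareCrossing r s) : L.ShareCrossing s r := by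
  obtain ⟨c, i, j, hr, hs⟩ := h
  exact ⟨c, j, i, hs, hr⟩

theorem boundariesMeet_symm (r s : L.Region) (h : L.BoundariesMeet r s) :
    L.BoundariesMeet s r := by
  rcases h with h | ⟨o, a, b, hr, hs⟩
  · exact .inl (L.shareCrossing_symm _ _ h)
  · exact .inr ⟨o, b, a, hs, hr⟩

/-! ### Euler's inequality -/

/-- One half of Euler's formula. The cycles modulo 2 carried by the curves form a space of dimension
at least `n + 1 + o` for `n > 0` crossings and `o` curves without crossings, since the `n` degree
conditions at the crossings add up to zero; all these cycles are boundaries of sets of regions, and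
the set of all regions has empty boundary. The truncated `n - 1` makes the statement right
for `n = 0` as well. -/
theorem euler_inequality [Fintype L.Crossing] [Fintype L.Circle] [Fintype L.Region] :
    2 * Fintype.card L.Crossing + Fintype.card L.Circle + 1 ≤
      (Fintype.card L.Crossing - 1) + Fintype.card L.Region := by
  classical
  let A : (L.Crossing × ZMod 4 → ZMod 2) →ₗ[ZMod 2] (L.Crossing × ZMod 4 → ZMod 2) :=
    LinearMap.funLeft (ZMod 2) (ZMod 2) L.opp - LinearMap.id
  let S : (L.Crossing × ZMod 4 → ZMod 2) →ₗ[ZMod 2] (L.Crossing → ZMod 2) :=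
    { toFun := fun z c => ∑ i : ZMod 4, z (c, i)
      map_add' := fun z z' => by ext c; simp [Finset.sum_add_distrib]
      map_smul' := fun a z => by ext c; simp [Finset.mul_sum] }
  let T : (L.Crossing → ZMod 2) →ₗ[ZMod 2] ZMod 2 := ∑ c, LinearMap.proj c
  let D : (L.Region → ZMod 2) →ₗ[ZMod 2] (L.Crossing × ZMod 4 → ZMod 2) × (L.Circle → ZMod 2) :=
    { toFun := fun f => (fun h => f (L.left h) + f (L.right h),
        fun o => f (L.side (o, true)) + f (L.side (o, false)))
      map_add' := fun f g => by
        ext <;> simp <;> ring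
      map_smul' := fun a f => by ext <;> simp [mul_add] }
  have hA (z) : z ∈ LinearMap.ker A ↔ ∀ h, z (L.opp h) = z h := by
    rw [LinearMap.mem_ker, funext_iff]
    exact forall_congr' fun h => sub_eq_zero
  -- `opp` is a fixed point free involution, so the symmetric functions on the half-edges
  -- make up at least half of all functions.
  have h1 : 4 * Fintype.card L.Crossing ≤ 2 * Module.finrank (ZMod 2) (LinearMap.ker A) := by
    have hle : LinearMap.range A ≤ LinearMap.ker A := by
      rintro _ ⟨z, rfl⟩
      rw [hA]
      intro h
      change z (L.opp (L.opp h)) - z (L.opp h) = z (L.opp h) - z h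
      rw [L.opp_opp]
      generalize z h = a
      generalize z (L.opp h) = b
      revert a b
      decide
    have h2 := Submodule.finrank_mono hle
    have h3 := LinearMap.finrank_range_add_finrank_ker A
    rw [Module.finrank_fintype_fun_eq_card, Fintype.card_prod, ZMod.card] at h3
    omega
  let S' := S.domRestrict (LinearMap.ker A)
  have h2 : Module.finrank (ZMod 2) (LinearMap.range S') ≤ Fintype.card L.Crossing - 1 := by
    have hle : LinearMap.range S' ≤ LinearMap.ker T := by
      rintro _ ⟨⟨z, hz⟩, rfl⟩
      rw [hA] at hz
      have : T (S z) = ∑ h : L.Crossing × ZMod 4, z h := by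
        rw [Fintype.sum_prod_type]
        simp [T, S]
      change T (S z) = 0
      rw [this]
      refine Finset.sum_involution (fun h _ => L.opp h) (fun h _ => ?_) (fun h _ _ => L.opp_ne h)
        (fun _ _ => Finset.mem_univ _) (fun h _ => L.opp_opp h)
      rw [hz]
      exact CharTwo.add_self_eq_zero _
    have h3 := Submodule.finrank_mono hle
    have h4 := LinearMap.finrank_range_add_finrank_ker T
    rw [Module.finrank_fintype_fun_eq_card] at h4
    rcases isEmpty_or_nonempty L.Crossing with hC | ⟨⟨c⟩⟩
    · have := Fintype.card_eq_zero (α := L.Crossing)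
      omega
    · have : LinearMap.range T = ⊤ := by
        rw [LinearMap.range_eq_top]
        intro a
        exact ⟨Pi.single c a, by simp [T]⟩
      rw [this, finrank_top, Module.finrank_self] at h4
      omega
  have h3 := LinearMap.finrank_range_add_finrank_ker S'
  let P : (LinearMap.ker S' × (L.Circle → ZMod 2)) →ₗ[ZMod 2]
      (L.Crossing × ZMod 4 → ZMod 2) × (L.Circle → ZMod 2) :=
    LinearMap.prodMap ((LinearMap.ker A).subtype ∘ₗ (LinearMap.ker S').subtype) LinearMap.id
  have hP : Function.Injective P := by
    rintro ⟨⟨⟨z, hz⟩, hz'⟩, y⟩ ⟨⟨⟨w, hw⟩, hw'⟩, x⟩ h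
    obtain ⟨rfl, rfl⟩ := Prod.mk.inj h
    rfl
  have hle : LinearMap.range P ≤ LinearMap.range D := by
    rintro _ ⟨⟨⟨⟨z, hz⟩, hz'⟩, y⟩, rfl⟩
    obtain ⟨f, hf, hf'⟩ := L.curvesSeparate z y ((hA z).1 hz) fun c => congrFun hz' c
    exact ⟨f, Prod.ext (funext fun h => (hf h).symm) (funext fun o => (hf' o).symm)⟩
  have h4 := Submodule.finrank_mono hle
  rw [LinearMap.finrank_range_of_inj hP, Module.finrank_prod,
    Module.finrank_fintype_fun_eq_card] at h4
  have h5 := LinearMap.finrank_range_add_finrank_ker D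
  rw [Module.finrank_fintype_fun_eq_card] at h5
  have h6 : 0 < Module.finrank (ZMod 2) (LinearMap.ker D) := by
    obtain ⟨r⟩ := L.nonempty_region
    have : (fun _ => 1 : L.Region → ZMod 2) ∈ LinearMap.ker D := by
      refine Prod.ext (funext fun h => ?_) (funext fun o => ?_) <;> exact CharTwo.add_self_eq_zero _
    refine Module.finrank_pos_iff_exists_ne_zero.2 ⟨⟨_, this⟩, fun h0 => ?_⟩
    exact one_ne_zero (congrFun (congrArg Subtype.val h0) r)
  omega

end

/-! ### Checkerboard colourings and counting -/

section

variable (L : LinkProjection)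

/-- A checkerboard colouring of the regions: the two sides of every edge and of every curve without
crossings have different colours. -/
def IsCheckerboard (f : L.Region → ZMod 2) : Prop :=
  (∀ h, f (L.left h) + f (L.right h) = 1) ∧
    ∀ o, f (L.side (o, true)) + f (L.side (o, false)) = 1

theorem exists_isCheckerboard : ∃ f, L.IsCheckerboard f := by
  obtain ⟨f, h1, h2⟩ := L.curvesSeparate (fun _ => 1) (fun _ => 1) (fun _ => rfl)
    (fun _ => by decide)
  exact ⟨f, fun h => (h1 h).symm, fun o => (h2 o).symm⟩

end

namespace IsCheckerboard

variable {L : LinkProjection} {f : L.Region → ZMod 2}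

theorem add_one (hf : L.IsCheckerboard f) : L.IsCheckerboard fun r => f r + 1 := by
  refine ⟨fun h => ?_, fun o => ?_⟩ <;> beta_reduce
  · have := hf.1 h
    generalize f (L.left h) = a at *
    generalize f (L.right h) = b at *
    revert a b; decide
  · have := hf.2 o
    generalize f (L.side (o, true)) = a at *
    generalize f (L.side (o, false)) = b at *
    revert a b; decide

theorem right (hf : L.IsCheckerboard f) (h : L.Crossing × ZMod 4) :
    f (L.right h) = f (L.left h) + 1 := by
  have := hf.1 h
  generalize f (L.left h) = a at *
  generalize f (L.right h) = b at *
  revert a b; decide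

theorem side_not (hf : L.IsCheckerboard f) (o : L.Circle) (a : Bool) :
    f (L.side (o, !a)) = f (L.side (o, a)) + 1 := by
  have := hf.2 o
  cases a <;> simp only [Bool.not_true, Bool.not_false] <;>
    generalize f (L.side (o, true)) = a at * <;>
    generalize f (L.side (o, false)) = b at * <;>
    revert a b <;> decide

theorem next (hf : L.IsCheckerboard f) (c : L.Crossing) (i : ZMod 4) :
    f (L.left (c, i + 1)) = f (L.left (c, i)) + 1 := by
  have := hf.right (c, i + 1)
  simp only [CurveSystem.right, add_sub_cancel_right] at this
  rw [this]
  generalize f (L.left (c, i + 1)) = a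
  revert a; decide

theorem opposite (hf : L.IsCheckerboard f) (c : L.Crossing) (i : ZMod 4) :
    f (L.left (c, i + 2)) = f (L.left (c, i)) := by
  rw [show i + 2 = i + 1 + 1 by ring, hf.next, hf.next]
  generalize f (L.left (c, i)) = a
  revert a; decide

theorem opposite_of_meet (hf : L.IsCheckerboard f) {r s : L.Region} (h : L.BoundariesMeet r s)
    (hrs : r ≠ s) (he : f r = f s) : ∃ c i, r = L.left (c, i) ∧ s = L.left (c, i + 2) := by
  rcases h with ⟨c, i, j, rfl, rfl⟩ | ⟨o, a, b, rfl, rfl⟩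
  · refine ⟨c, i, rfl, ?_⟩
    obtain ⟨k, rfl⟩ : ∃ k, j = i + k := ⟨j - i, by ring⟩
    rcases zmod4_cases k with rfl | rfl | rfl | rfl
    · simp at hrs
    · rw [hf.next] at he
      simp at he
    · rfl
    · rw [show i + 3 = i + 2 + 1 by ring, hf.next, hf.opposite] at he
      simp at he
  · by_cases hab : a = b
    · simp [hab] at hrs
    · obtain rfl : b = !a := by cases a <;> cases b <;> simp_all
      rw [hf.side_not] at he
      simp at he

theorem adjacent_of_meet (hf : L.IsCheckerboard f) {r s : L.Region} (h : L.BoundariesMeet r s)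
    (he : f r ≠ f s) :
    (∃ h, r = L.left h ∧ s = L.right h) ∨ ∃ o a, r = L.side (o, a) ∧ s = L.side (o, !a) := by
  rcases h with ⟨c, i, j, rfl, rfl⟩ | ⟨o, a, b, rfl, rfl⟩
  · left
    obtain ⟨k, rfl⟩ : ∃ k, j = i + k := ⟨j - i, by ring⟩
    rcases zmod4_cases k with rfl | rfl | rfl | rfl
    · simp at he
    · refine ⟨L.opp (c, i + 1), ?_, (L.right_opp _).symm⟩
      rw [L.left_opp]
      simp [CurveSystem.right]
    · exact absurd (hf.opposite c i).symm he
    · refine ⟨(c, i), rfl, ?_⟩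
      rw [CurveSystem.right, show i - 1 = i + 3 by rw [sub_eq_add_neg]; congr 1]
  · right
    refine ⟨o, a, rfl, ?_⟩
    by_cases hab : a = b
    · simp [hab] at he
    · obtain rfl : b = !a := by cases a <;> cases b <;> simp_all
      rfl

/-- Of the four corners at a crossing, two have either colour. -/
theorem card_corner [Fintype L.Crossing] (hf : L.IsCheckerboard f) (x : ZMod 2) :
    (Finset.univ.filter fun h => f (L.left h) = x).card = 2 * Fintype.card L.Crossing := by
  classical
  let t (x : ZMod 2) := Finset.univ.filter fun h => f (L.left h) = x
  have h1 : (t x).card = (t (x + 1)).card := by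
    refine Finset.card_bij' (fun h _ => (h.1, h.2 + 1)) (fun h _ => (h.1, h.2 - 1)) ?_ ?_ ?_ ?_
    · rintro ⟨c, i⟩ h
      simp only [t, Finset.mem_filter_univ] at h ⊢
      rw [hf.next, h]
    · rintro ⟨c, i⟩ h
      simp only [t, Finset.mem_filter_univ] at h ⊢
      have := hf.next c (i - 1)
      rw [sub_add_cancel, h] at this
      exact (add_right_cancel this).symm
    · simp
    · simp
  have h2 := Finset.card_filter_add_card_filter_not (s := Finset.univ)
    (fun h => f (L.left h) = x)
  have h3 : (Finset.univ.filter fun h => ¬ f (L.left h) = x) = t (x + 1) := by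
    refine Finset.filter_congr fun h _ => ?_
    generalize f (L.left h) = a
    clear h1 h2
    revert a x; decide
  rw [h3, Finset.card_univ, Fintype.card_prod, ZMod.card] at h2
  change (t x).card + _ = _ at h2
  change (t x).card = _
  omega

/-- Two regions of the same colour can only meet at a pair of opposite corners. -/
theorem card_mul_pred_le [Fintype L.Crossing] [Fintype L.Region]
    (hf : L.IsCheckerboard f) (hm : ∀ r s, r ≠ s → L.BoundariesMeet r s)
    (x : ZMod 2) : (Finset.univ.filter fun r => f r = x).card *
      ((Finset.univ.filter fun r => f r = x).card - 1) ≤ 2 * Fintype.card L.Crossing := by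
  classical
  rw [Nat.mul_sub_one, ← Finset.offDiag_card, ← hf.card_corner x]
  refine Finset.card_le_card_of_surjOn
    (fun h => (L.left h, L.left (h.1, h.2 + 2))) ?_
  rintro ⟨r, s⟩ h
  simp only [Finset.coe_offDiag, Set.mem_offDiag, Finset.mem_coe, Finset.mem_filter_univ] at h
  obtain ⟨h1, h2, h3⟩ := h
  obtain ⟨c, i, rfl, rfl⟩ := hf.opposite_of_meet (hm r s h3) h3 (h1.trans h2.symm)
  exact ⟨(c, i), by simpa using h1, rfl⟩

/-- Two regions of different colours can only meet along an edge or a curve without crossings. -/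
theorem card_mul_card_le [Fintype L.Crossing] [Fintype L.Circle] [Fintype L.Region]
    (hf : L.IsCheckerboard f) (hm : ∀ r s, r ≠ s → L.BoundariesMeet r s) :
    (Finset.univ.filter fun r => f r = 1).card * (Finset.univ.filter fun r => f r = 0).card ≤
      2 * Fintype.card L.Crossing + Fintype.card L.Circle := by
  classical
  have hs (o) : ∃ a, f (L.side (o, a)) = 1 := by
    have h := hf.side_not o true
    by_cases h1 : f (L.side (o, true)) = 1
    · exact ⟨_, h1⟩
    · refine ⟨!true, h.trans ?_⟩
      generalize f (L.side (o, true)) = a at h1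
      revert a; decide
  choose a ha using hs
  rw [← Finset.card_product, ← hf.card_corner 1, ← Finset.card_univ, ← Finset.card_disjSum]
  refine Finset.card_le_card_of_surjOn
    (Sum.elim (fun h => (L.left h, L.right h)) fun o => (L.side (o, a o), L.side (o, !a o))) ?_
  rintro ⟨r, s⟩ h
  simp only [Finset.coe_product, Set.mem_prod, Finset.mem_coe, Finset.mem_filter_univ] at h
  obtain ⟨h1, h2⟩ := h
  have hne : f r ≠ f s := by rw [h1, h2]; decide
  rcases hf.adjacent_of_meet (hm r s (fun h => hne (congrArg f h))) hne with
    ⟨h, rfl, rfl⟩ | ⟨o, b, rfl, rfl⟩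
  · exact ⟨inl h, by simpa using h1, rfl⟩
  · obtain rfl : b = a o := by
      by_contra hb
      obtain hb : a o = !b := by revert hb; cases a o <;> cases b <;> decide
      have := ha o
      rw [hb, h2] at this
      exact zero_ne_one this
    exact ⟨inr o, by simp, rfl⟩

/-- If the counting bound for pairs of different colours is attained, then every such pair is
separated by exactly one edge. -/
theorem halfEdge_injective [Fintype L.Crossing] [Fintype L.Region]
    (hf : L.IsCheckerboard f) (hm : ∀ r s, r ≠ s → L.BoundariesMeet r s)
    (ho : IsEmpty L.Circle)
    (hc : 2 * Fintype.card L.Crossing ≤ (Finset.univ.filter fun r => f r = 1).card *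
      (Finset.univ.filter fun r => f r = 0).card) {h h' : L.Crossing × ZMod 4}
    (h1 : L.left h = L.left h') (h2 : L.right h = L.right h') : h = h' := by
  classical
  have key : Set.InjOn (fun h => (L.left h, L.right h))
      ((Finset.univ.filter fun h => f (L.left h) = 1 : Finset _) : Set (L.Crossing × ZMod 4)) := by
    refine Finset.injOn_of_surjOn_of_card_le (t := (Finset.univ.filter fun r => f r = 1) ×ˢ
      (Finset.univ.filter fun r => f r = 0)) _ ?_ ?_ ?_
    · intro h hh
      simp only [Finset.coe_filter, Finset.mem_univ, true_and, Set.mem_ofPred_eq] at hh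
      simp only [Finset.coe_product, Set.mem_prod, Finset.mem_coe, Finset.mem_filter_univ]
      exact ⟨hh, by rw [hf.right, hh]; decide⟩
    · rintro ⟨r, s⟩ h
      simp only [Finset.coe_product, Set.mem_prod, Finset.mem_coe, Finset.mem_filter_univ] at h
      obtain ⟨h1, h2⟩ := h
      have hne : f r ≠ f s := by rw [h1, h2]; decide
      rcases hf.adjacent_of_meet (hm r s (fun h => hne (congrArg f h))) hne with
        ⟨h, rfl, rfl⟩ | ⟨o, b, rfl, rfl⟩
      · exact ⟨h, by simpa using h1, rfl⟩
      · exact ho.elim o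
    · rw [hf.card_corner, Finset.card_product]
      exact hc
  by_cases hx : f (L.left h) = 1
  · exact key (by simpa using hx) (by simpa [← h1] using hx) (Prod.ext h1 h2)
  · have hy : f (L.right h) = 1 := by
      rw [hf.right]
      generalize f (L.left h) = a at hx
      revert a; decide
    have := key (x₁ := L.opp h) (x₂ := L.opp h')
      (by rw [Finset.mem_coe, Finset.mem_filter_univ, L.left_opp, hy])
      (by rw [Finset.mem_coe, Finset.mem_filter_univ, L.left_opp, ← h2, hy])
      (Prod.ext ((L.left_opp h).trans (h2.trans (L.left_opp h').symm))
        ((L.right_opp h).trans (h1.trans (L.right_opp h').symm)))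
    rw [← L.opp_opp h, this, L.opp_opp]

end IsCheckerboard

/-- The numbers left over by the three counting bounds and Euler's formula: `n` crossings,
`o` curves without crossings, `b` black and `w` white regions. -/
theorem census_arith {n o b w : ℕ} (hb : 0 < n → 0 < b) (hw : 0 < n → 0 < w)
    (ho : 0 < n ∨ 0 < o) (hbb : b * (b - 1) ≤ 2 * n) (hww : w * (w - 1) ≤ 2 * n)
    (hbw : b * w ≤ 2 * n + o) (he : 2 * n + o + 1 ≤ (n - 1) + (b + w)) :
    n = 0 ∧ o = 1 ∨ o = 0 ∧ 0 < n ∧ n ≤ 3 ∧ (b = n ∧ w = 2 ∨ w = n ∧ b = 2) := by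
  have bound {b w : ℕ} (hwb : w ≤ b) (hbb : b * (b - 1) ≤ 2 * n)
      (he : 2 * n + o + 1 ≤ (n - 1) + (b + w)) : b ≤ 4 := by
    by_contra! h
    obtain ⟨k, rfl⟩ : ∃ k, b = k + 5 := ⟨b - 5, by omega⟩
    rw [show k + 5 - 1 = k + 4 by omega] at hbb
    have : (k + 5) * (k + 4) + 1 ≤ 4 * (k + 5) := by omega
    nlinarith
  obtain ⟨h1, h2⟩ : b ≤ 4 ∧ w ≤ 4 := by
    rcases le_total w b with h | h
    · have := bound h hbb he
      omega
    · have := bound h hww (by omega)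
      omega
  interval_cases b <;> interval_cases w <;> omega

/-! ### Recognizing the standard projections -/

/-- In a standard projection a half-edge is determined by the regions on its two sides. -/
theorem torusLabel_injective {n : ℕ} {c c' : ZMod n} {i i' : ZMod 4}
    (h1 : torusLabel n (inl (c, i)) = torusLabel n (inl (c', i')))
    (h2 : torusLabel n (inl (c, i - 1)) = torusLabel n (inl (c', i' - 1))) : (c, i) = (c', i') := by
  have e0 : (0 : ZMod 4) - 1 = 3 := rfl
  have e1 : (1 : ZMod 4) - 1 = 0 := rfl
  have e2 : (2 : ZMod 4) - 1 = 1 := rfl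
  have e3 : (3 : ZMod 4) - 1 = 2 := rfl
  rcases zmod4_cases i with rfl | rfl | rfl | rfl <;>
    rcases zmod4_cases i' with rfl | rfl | rfl | rfl <;>
    simp_all [torusLabel_zero, torusLabel_one, torusLabel_two, torusLabel_three]

/-- A projection is the standard one as soon as its crossings and regions can be numbered in such a
way that the corners of each crossing belong to the expected regions. The gluing of the half-edges
then takes care of itself, because in `torus n` half-edges are told apart by their two sides. -/
theorem same_torus_of_corners {L : LinkProjection} {n : ℕ} [NeZero n] [IsEmpty L.Circle]
    (E : L.Crossing ≃ ZMod n) (k : L.Crossing → ZMod 4) {μ : Bool ⊕ ZMod n → L.Region}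
    (hμ : Function.Injective μ)
    (h0 : ∀ c, L.left (c, k c) = μ (inr (E c))) (h1 : ∀ c, L.left (c, k c + 1) = μ (inl true))
    (h2 : ∀ c, L.left (c, k c + 2) = μ (inr (E c - 1)))
    (h3 : ∀ c, L.left (c, k c + 3) = μ (inl false)) : L.Same (torus n) := by
  let e : L.Crossing × ZMod 4 ≃ ZMod n × ZMod 4 :=
    { toFun := fun h => (E h.1, h.2 - k h.1)
      invFun := fun h => (E.symm h.1, h.2 + k (E.symm h.1))
      left_inv := fun h => by simp
      right_inv := fun h => by simp }
  have key (h) : μ (torusLabel n (inl (e h))) = L.left h := by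
    obtain ⟨c, i⟩ := h
    obtain ⟨j, rfl⟩ : ∃ j, i = k c + j := ⟨i - k c, by ring⟩
    have he : e (c, k c + j) = (E c, j) := by simp [e]
    rw [he]
    rcases zmod4_cases j with rfl | rfl | rfl | rfl
    · rw [add_zero, h0, torusLabel_zero]
    · rw [h1, torusLabel_one]
    · rw [h2, torusLabel_two]
    · rw [h3, torusLabel_three]
  have keyr (h) : μ (torusLabel n (inl ((e h).1, (e h).2 - 1))) = L.right h := by
    rw [CurveSystem.right, ← key]
    simp only [e, Equiv.coe_fn_mk]
    rw [sub_right_comm]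
  have hl (h) : torusLabel n (inl (torusOpp n h)) = torusLabel n (inl (h.1, h.2 - 1)) :=
    Quotient.exact ((torus n).left_opp h)
  have hr (h) : torusLabel n (inl ((torusOpp n h).1, (torusOpp n h).2 - 1)) =
      torusLabel n (inl h) :=
    Quotient.exact ((torus n).right_opp h)
  have : IsEmpty ((torus n).Circle × Bool) := ⟨fun s => s.1.elim⟩
  refine ⟨e, Equiv.equivOfIsEmpty _ _, fun c i => ?_, fun h => ?_, fun o => isEmptyElim o, ?_⟩
  · exact Prod.ext rfl (add_sub_right_comm i 1 (k c))
  · change e (L.opp h) = torusOpp n (e h)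
    refine torusLabel_injective (hμ ?_) (hμ ?_)
    · exact (key _).trans ((L.left_opp h).trans ((keyr h).symm.trans (congrArg μ (hl _).symm)))
    · exact (keyr _).trans ((L.right_opp h).trans ((key h).symm.trans (congrArg μ (hr _).symm)))
  · rintro (s | s) (t | t)
    · change _ ↔ torusLabel n (inl (e s)) = torusLabel n (inl (e t))
      rw [← hμ.eq_iff, key, key]
      exact Quotient.eq.symm
    all_goals first | exact isEmptyElim s | exact isEmptyElim t

/-- On at most three points, a permutation that relates any two of them is a cycle. -/
theorem exists_numbering {n : ℕ} [NeZero n] (hn : n ≤ 3) (σ : Equiv.Perm (ZMod n))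
    (hσ : ∀ x y, x ≠ y → σ x = y ∨ σ y = x) :
    ∃ e : ZMod n ≃ ZMod n, ∀ x, e (σ x) = e x - 1 := by
  suffices ∃ e : ZMod n → ZMod n, Function.Injective e ∧ ∀ x, e (σ x) = e x - 1 by
    obtain ⟨e, he, h⟩ := this
    exact ⟨Equiv.ofBijective e (Finite.injective_iff_bijective.1 he), h⟩
  have hi := σ.injective
  generalize (σ : ZMod n → ZMod n) = s at *
  have h2 : ∀ s : Fin 2 → Fin 2, (∀ x y, x ≠ y → s x = y ∨ s y = x) → Function.Injective s →
      ∃ e : Fin 2 → Fin 2, Function.Injective e ∧ ∀ x, e (s x) = e x - 1 := by decide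
  have h3 : ∀ s : Fin 3 → Fin 3, (∀ x y, x ≠ y → s x = y ∨ s y = x) → Function.Injective s →
      ∃ e : Fin 3 → Fin 3, Function.Injective e ∧ ∀ x, e (s x) = e x - 1 := by decide
  obtain rfl | rfl | rfl : n = 1 ∨ n = 2 ∨ n = 3 := by
    have := NeZero.ne n
    omega
  · exact ⟨id, Function.injective_id, fun _ => Subsingleton.elim _ _⟩
  · exact h2 s hσ hi
  · exact h3 s hσ hi

section

variable {L : LinkProjection} {f : L.Region → ZMod 2}

/-- The two white corners of a crossing belong to different regions, if there are two white and at
most three black regions, all regions meet, and half-edges are told apart by their two sides. -/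
theorem IsCheckerboard.white_corners_ne [Fintype L.Region] (hf : L.IsCheckerboard f)
    (hm : ∀ r s, r ≠ s → L.BoundariesMeet r s)
    (hinj : ∀ {h h'}, L.left h = L.left h' → L.right h = L.right h' → h = h')
    {p m : L.Region} (hpm : p ≠ m) (hw : ∀ r, f r = 0 ↔ r = p ∨ r = m)
    (hb : (Finset.univ.filter fun r => f r = 1).card ≤ 3) (c : L.Crossing) (i : ZMod 4)
    (hi : f (L.left (c, i)) = 0) : L.left (c, i) ≠ L.left (c, i + 2) := by
  classical
  intro hq
  have s2 : ∀ i : ZMod 4, i + 2 ≠ i := by decide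
  have a1 : ∀ i : ZMod 4, i + 1 - 1 = i := by decide
  have a2 : ∀ i : ZMod 4, i + 2 - 1 = i + 1 := by decide
  have a3 : ∀ i : ZMod 4, i + 3 - 1 = i + 2 := by decide
  have a0 : ∀ i : ZMod 4, i - 1 = i + 3 := by decide
  have a22 : ∀ i : ZMod 4, i + 2 + 2 = i := by decide
  have a12 : ∀ i : ZMod 4, i + 1 + 2 = i + 3 := by decide
  have a32 : ∀ i : ZMod 4, i + 3 + 2 = i + 1 := by decide
  have f3 (c) (i) : f (L.left (c, i + 3)) = f (L.left (c, i)) + 1 := by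
    rw [← a12, hf.opposite, hf.next]
  obtain ⟨q', hq', hq'w, hwhite⟩ : ∃ q', q' ≠ L.left (c, i) ∧ f q' = 0 ∧
      ∀ r, f r = 0 → r = L.left (c, i) ∨ r = q' := by
    rcases (hw _).1 hi with h | h
    · exact ⟨m, h ▸ hpm.symm, (hw m).2 (.inr rfl), fun r hr => h ▸ (hw r).1 hr⟩
    · exact ⟨p, h ▸ hpm, (hw p).2 (.inl rfl), fun r hr => h ▸ ((hw r).1 hr).symm⟩
  -- Let `a`, `b` be the black regions at `c`, and `x`, `y` those at a crossing `c'` shared by the two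
  -- white regions. All half-edges between `left (c, i)` and `a` or `b` issue from `c`.
  have hab : L.left (c, i + 1) ≠ L.left (c, i + 3) := by
    intro h
    have := @hinj (c, i) (c, i + 2) hq (by simp only [CurveSystem.right, a2, a0, h])
    exact s2 i (congrArg Prod.snd this).symm
  obtain ⟨c', j, hj, hj2⟩ := hf.opposite_of_meet (hm _ _ hq'.symm) hq'.symm (hi.trans hq'w.symm)
  have hi' : f (L.left (c', j)) = 0 := hj ▸ hi
  have hxa : L.left (c', j + 1) ≠ L.left (c, i + 1) := fun h => by
    obtain ⟨rfl, h'⟩ := Prod.mk.inj (@hinj (c', j + 1) (c, i + 1) h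
      (by simp only [CurveSystem.right, a1, hj]))
    obtain rfl := add_right_cancel h'
    exact hq' (hj2.trans hq.symm)
  have hxb : L.left (c', j + 1) ≠ L.left (c, i + 3) := fun h => by
    obtain ⟨rfl, h'⟩ := Prod.mk.inj (@hinj (c', j + 1) (c, i + 3) h
      (by simp only [CurveSystem.right, a1, a3, ← hj, hq]))
    obtain rfl : j = i + 2 := by rw [← a1 j, h', a3]
    exact hq' (hj2.trans (by rw [a22]))
  have hyb : L.left (c', j + 3) ≠ L.left (c, i + 3) := fun h => by
    obtain ⟨rfl, rfl⟩ := Prod.mk.inj (@hinj (c', j) (c, i) hj.symm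
      (by simp only [CurveSystem.right, a0, h]))
    exact hq' (hj2.trans hq.symm)
  have hya : L.left (c', j + 3) ≠ L.left (c, i + 1) := fun h => by
    obtain ⟨rfl, rfl⟩ := Prod.mk.inj (@hinj (c', j) (c, i + 2) (hj.symm.trans hq)
      (by simp only [CurveSystem.right, a0 j, a2, h]))
    exact hq' (hj2.trans (by rw [a22]))
  -- There is no room for four black regions.
  have hxy : L.left (c', j + 1) = L.left (c', j + 3) := by
    by_contra hxy
    have hle := Finset.card_le_card (s := {L.left (c, i + 1), L.left (c, i + 3),
      L.left (c', j + 1), L.left (c', j + 3)}) (t := Finset.univ.filter fun r => f r = 1) (by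
        intro r hr
        simp only [Finset.mem_insert, Finset.mem_singleton] at hr
        rw [Finset.mem_filter_univ]
        rcases hr with rfl | rfl | rfl | rfl <;> simp [hf.next, f3, hi, hi'])
    rw [Finset.card_insert_of_notMem (by simp [hab, hxa.symm, hya.symm]),
      Finset.card_insert_of_notMem (by simp [hxb.symm, hyb.symm]), Finset.card_pair hxy] at hle
    omega
  -- All half-edges along the black region `left (c', j + 1)` issue from `c'`, so that this region
  -- cannot meet another black one.
  obtain ⟨d, l, hl, hl2⟩ := hf.opposite_of_meet (hm _ _ hxa) hxa
    (by rw [hf.next, hf.next, hi, hi'])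
  have hz : f (L.right (d, l)) = 0 := by
    rw [hf.right, ← hl, hf.next, hi']
    decide
  rcases hwhite _ hz with hz | hz
  · obtain ⟨rfl, rfl⟩ := Prod.mk.inj (@hinj (d, l) (c', j + 1) hl.symm
      (by rw [hz, hj]; simp only [CurveSystem.right, a1]))
    exact hxa (by rw [hl2, a12, hxy])
  · obtain ⟨rfl, rfl⟩ := Prod.mk.inj (@hinj (d, l) (c', j + 3) (hl.symm.trans hxy)
      (by rw [hz, hj2]; simp only [CurveSystem.right, a3]))
    exact hxa (by rw [hl2, a32])

/-- A projection in which all regions meet, with as many black regions as crossings and two white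
regions, is a standard projection of a torus link. Going from the black region on one side of a
crossing to the one on the other side permutes the black regions; this permutation is a cycle
because any two black regions meet. -/
theorem IsCheckerboard.same_torus [Fintype L.Region] [Fintype L.Crossing]
    (hf : L.IsCheckerboard f) (hm : ∀ r s, r ≠ s → L.BoundariesMeet r s) [IsEmpty L.Circle]
    (hinj : ∀ {h h'}, L.left h = L.left h' → L.right h = L.right h' → h = h')
    {n : ℕ} [NeZero n] (hn : n ≤ 3) (hc : Fintype.card L.Crossing = n)
    (hb : (Finset.univ.filter fun r => f r = 1).card = n)
    (hw : (Finset.univ.filter fun r => f r = 0).card = 2) : L.Same (torus n) := by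
  classical
  obtain ⟨p, m, hpm, hpm'⟩ := Finset.card_eq_two.1 hw
  have hw' (r) : f r = 0 ↔ r = p ∨ r = m := by
    rw [← Finset.mem_filter_univ (p := fun r => f r = 0), hpm']
    simp
  have hne := hf.white_corners_ne hm hinj hpm hw' (hb.trans_le hn)
  have a0 : ∀ i : ZMod 4, i - 1 + 1 = i := by decide
  have a2 : ∀ i : ZMod 4, i - 1 + 3 = i + 2 := by decide
  have a1 : ∀ i : ZMod 4, i + 1 + 1 = i + 2 := by decide
  have a3 : ∀ i : ZMod 4, i + 1 + 3 = i := by decide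
  have a4 : ∀ i : ZMod 4, i - 1 = i + 3 := by decide
  have a5 : ∀ i : ZMod 4, i + 2 - 1 = i + 1 := by decide
  have a6 : ∀ i : ZMod 4, i + 2 + 2 = i := by decide
  have hk (c) : ∃ k : ZMod 4, L.left (c, k + 1) = p ∧ L.left (c, k + 3) = m := by
    obtain ⟨i, hi⟩ : ∃ i, f (L.left (c, i)) = 0 := by
      have h := hf.next c 0
      by_cases h0 : f (L.left (c, 0)) = 0
      · exact ⟨_, h0⟩
      · refine ⟨0 + 1, h.trans ?_⟩
        generalize f (L.left (c, 0)) = a at h0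
        revert a; decide
    have h1 := hne c i hi
    have h2 := (hw' _).1 ((hf.opposite c i).trans hi)
    rcases (hw' _).1 hi with h | h
    · refine ⟨i - 1, by rw [a0, h], ?_⟩
      rw [a2]
      exact h2.resolve_left fun h' => h1 (h.trans h'.symm)
    · refine ⟨i + 1, ?_, by rw [a3, h]⟩
      rw [a1]
      exact h2.resolve_right fun h' => h1 (h.trans h'.symm)
  choose k hkp hkm using hk
  have hblack (c) : f (L.left (c, k c)) = 1 := by
    have h := hf.next c (k c)
    rw [hkp, (hw' p).2 (.inl rfl)] at h
    generalize f (L.left (c, k c)) = a at h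
    revert a; decide
  let head (c : L.Crossing) : {r // f r = 1} := ⟨L.left (c, k c), hblack c⟩
  let tail (c : L.Crossing) : {r // f r = 1} :=
    ⟨L.left (c, k c + 2), (hf.opposite _ _).trans (hblack c)⟩
  have hcard : Fintype.card L.Crossing = Fintype.card {r // f r = 1} := by
    rw [hc, Fintype.card_subtype, hb]
  have hhead : Function.Injective head := fun c c' h =>
    congrArg Prod.fst (@hinj (c, k c) (c', k c') (congrArg Subtype.val h)
      (by simp only [CurveSystem.right, a4, hkm]))
  have htail : Function.Injective tail := fun c c' h =>
    congrArg Prod.fst (@hinj (c, k c + 2) (c', k c' + 2) (congrArg Subtype.val h)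
      (by simp only [CurveSystem.right, a5, hkp]))
  let H := Equiv.ofBijective head ((Fintype.bijective_iff_injective_and_card _).2 ⟨hhead, hcard⟩)
  let T := Equiv.ofBijective tail ((Fintype.bijective_iff_injective_and_card _).2 ⟨htail, hcard⟩)
  let σ : Equiv.Perm L.Crossing := T.trans H.symm
  have hσ (c) : head (σ c) = tail c := H.apply_symm_apply (T c)
  have hcyc (c c') (hcc : c ≠ c') : σ c = c' ∨ σ c' = c := by
    have h1 : (head c : L.Region) ≠ head c' := fun h => hcc (hhead (Subtype.ext h))
    obtain ⟨d, i, hi, hi'⟩ := hf.opposite_of_meet (hm _ _ h1) h1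
      ((hblack c).trans (hblack c').symm)
    obtain ⟨t, rfl⟩ : ∃ t, i = k d + t := ⟨i - k d, by ring⟩
    have hw1 : L.left (d, k d + t) ≠ p := fun h => by
      have := (head c).2
      rw [hi, h, (hw' p).2 (.inl rfl)] at this
      exact zero_ne_one this
    have hw2 : L.left (d, k d + t) ≠ m := fun h => by
      have := (head c).2
      rw [hi, h, (hw' m).2 (.inr rfl)] at this
      exact zero_ne_one this
    rcases zmod4_cases t with rfl | rfl | rfl | rfl
    · rw [add_zero] at hi hi'
      obtain rfl : c = d := hhead (Subtype.ext hi)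
      exact .inl (hhead ((hσ c).trans (Subtype.ext hi'.symm)))
    · exact absurd (hkp d) hw1
    · rw [a6] at hi'
      obtain rfl : c' = d := hhead (Subtype.ext hi')
      exact .inr (hhead ((hσ c').trans (Subtype.ext hi.symm)))
    · exact absurd (hkm d) hw2
  let E₀ : L.Crossing ≃ ZMod n := Fintype.equivOfCardEq (by rw [hc, ZMod.card])
  obtain ⟨e, he⟩ := exists_numbering hn (E₀.symm.trans (σ.trans E₀)) fun x y hxy => by
    rcases hcyc (E₀.symm x) (E₀.symm y) (fun h => hxy (E₀.symm.injective h)) with h | h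
    · exact .inl (by simp [h])
    · exact .inr (by simp [h])
  let E := E₀.trans e
  have hE (c) : E (σ c) = E c - 1 := by simpa [E] using he (E₀ c)
  have hpw : f p = 0 := (hw' p).2 (.inl rfl)
  have hmw : f m = 0 := (hw' m).2 (.inr rfl)
  refine same_torus_of_corners E k (μ := Sum.elim (fun b => if b then p else m)
    fun x => head (E.symm x)) ?_ (fun c => ?_) hkp (fun c => ?_) hkm
  · have hx (x) (r) (hr : f r = 0) : (head x : L.Region) ≠ r := fun h => by
      have := (head x).2
      rw [h, hr] at this
      exact zero_ne_one this
    rintro (a | x) (b | y) h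
    · cases a <;> cases b <;> simp_all
    · cases a
      · exact absurd h.symm (hx _ _ hmw)
      · exact absurd h.symm (hx _ _ hpw)
    · cases b
      · exact absurd h (hx _ _ hmw)
      · exact absurd h (hx _ _ hpw)
    · exact congrArg inr (E.symm.injective (hhead (Subtype.ext h)))
  · simp [head]
  · rw [Sum.elim_inr, ← hE, Equiv.symm_apply_apply, hσ]

end

/-! ### The classification -/

section

variable {L : LinkProjection}

theorem IsCheckerboard.side_ne {f : L.Region → ZMod 2} (hf : L.IsCheckerboard f) (o : L.Circle) :
    L.side (o, true) ≠ L.side (o, false) := fun h => by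
  have := hf.2 o
  rw [h] at this
  generalize f (L.side (o, false)) = a at this
  revert a; decide

theorem same_trivialCircle [IsEmpty L.Crossing] [Unique L.Circle] : L.Same trivialCircle := by
  obtain ⟨f, hf⟩ := L.exists_isCheckerboard
  have : IsEmpty (trivialCircle.Crossing × ZMod 4) := ⟨fun h => h.1.elim⟩
  refine ⟨Equiv.equivOfIsEmpty _ _, Equiv.prodCongr (Equiv.ofUnique L.Circle Unit) (Equiv.refl _),
    isEmptyElim, fun h => isEmptyElim h.1, fun o b => rfl, ?_⟩
  rintro (s | ⟨o, a⟩) (t | ⟨o', b⟩)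
  · exact isEmptyElim s.1
  · exact isEmptyElim s.1
  · exact isEmptyElim t.1
  obtain rfl := Subsingleton.elim o o'
  change _ ↔ (inr ((), a) : (Empty × ZMod 4) ⊕ (Unit × Bool)) = inr ((), b)
  have h1 : L.sameRegion.r (inr (o, a)) (inr (o, b)) ↔ L.side (o, a) = L.side (o, b) :=
    Quotient.eq.symm
  rw [h1]
  have h2 := hf.side_ne o
  cases a <;> cases b <;> simp [h2, h2.symm]

/-- If the boundaries of all regions meet, the projection is the trivial circle or a standard
projection of a torus link with at most three crossings. -/
theorem classification (hm : ∀ r s, r ≠ s → L.BoundariesMeet r s) :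
    L.Same trivialCircle ∨ L.Same (torus 1) ∨ L.Same (torus 2) ∨ L.Same (torus 3) := by
  classical
  have := L.finite_crossing
  have := L.finite_circle
  have := L.finite_region
  have := Fintype.ofFinite L.Crossing
  have := Fintype.ofFinite L.Circle
  have := Fintype.ofFinite L.Region
  obtain ⟨f, hf⟩ := L.exists_isCheckerboard
  have hex (x : ZMod 2) (h : 0 < Fintype.card L.Crossing) :
      0 < (Finset.univ.filter fun r => f r = x).card := by
    have h1 := hf.card_corner x
    obtain ⟨h, hh⟩ := Finset.card_pos.1 (show 0 < (Finset.univ.filter fun h =>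
      f (L.left h) = x).card by omega)
    exact Finset.card_pos.2 ⟨L.left h, by simpa using hh⟩
  have hsum : (Finset.univ.filter fun r => f r = 1).card +
      (Finset.univ.filter fun r => f r = 0).card = Fintype.card L.Region := by
    rw [← Finset.card_univ,
      ← Finset.card_filter_add_card_filter_not (s := Finset.univ) (fun r => f r = 1)]
    congr 2
    refine Finset.filter_congr fun r _ => ?_
    generalize f r = a
    revert a; decide
  have hne : 0 < Fintype.card L.Crossing ∨ 0 < Fintype.card L.Circle := by
    rw [Fintype.card_pos_iff, Fintype.card_pos_iff, ← nonempty_sum]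
    exact L.nonempty
  have hbw := hf.card_mul_card_le hm
  rcases census_arith (hex 1) (hex 0) hne (hf.card_mul_pred_le hm 1) (hf.card_mul_pred_le hm 0)
    hbw (hsum ▸ L.euler_inequality) with ⟨hn, ho⟩ | ⟨ho, hn, hn3, hcol⟩
  · have := Fintype.card_eq_zero_iff.1 hn
    have := (Fintype.card_eq_one_iff_nonempty_unique.1 ho).some
    exact .inl same_trivialCircle
  · have ho' := Fintype.card_eq_zero_iff.1 ho
    have hinj {h h'} : L.left h = L.left h' → L.right h = L.right h' → h = h' :=
      hf.halfEdge_injective hm ho' (by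
        rcases hcol with ⟨h1, h2⟩ | ⟨h1, h2⟩
        · rw [h1, h2, mul_comm]
        · rw [h1, h2])
    have key (n : ℕ) [NeZero n] (hc : Fintype.card L.Crossing = n) : L.Same (torus n) := by
      subst hc
      rcases hcol with ⟨h1, h2⟩ | ⟨h1, h2⟩
      · exact hf.same_torus hm hinj hn3 rfl h1 h2
      -- The colours have to be exchanged.
      · refine hf.add_one.same_torus hm hinj hn3 rfl ?_ ?_
        · simpa using h1
        · refine Eq.trans (congrArg Finset.card ?_) h2
          refine Finset.filter_congr fun r _ => ?_
          generalize f r = a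
          revert a; decide
    right
    obtain h | h | h : Fintype.card L.Crossing = 1 ∨ Fintype.card L.Crossing = 2 ∨
      Fintype.card L.Crossing = 3 := by omega
    · exact .inl (key 1 h)
    · exact .inr (.inl (key 2 h))
    · exact .inr (.inr (key 3 h))

/-! ### The four projections -/

/-- The property that all regions share crossings is invariant under homeomorphism. -/
theorem shareCrossing_of_same {M : LinkProjection} [IsEmpty M.Circle] (h : L.Same M)
    (hM : ∀ r s, r ≠ s → M.ShareCrossing r s) (r s : L.Region) (hrs : r ≠ s) :
    L.ShareCrossing r s := by
  obtain ⟨e, d, he, -, -, hr⟩ := h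
  have hleft (h h') : L.left h = L.left h' ↔ M.left (e h) = M.left (e h') :=
    Quotient.eq.trans ((hr (inl h) (inl h')).trans Quotient.eq.symm)
  have hrot (c : L.Crossing) (i t : ZMod 4) :
      e (c, i + t) = ((e (c, i)).1, (e (c, i)).2 + t) := by
    have h2 (i) : e (c, i + 2) = ((e (c, i)).1, (e (c, i)).2 + 2) := by
      rw [show i + 2 = i + 1 + 1 by ring, he, he]
      exact Prod.ext rfl (by ring)
    rcases zmod4_cases t with rfl | rfl | rfl | rfl
    · simp
    · exact he c i
    · exact h2 i
    · rw [show i + 3 = i + 1 + 2 by ring, h2, he]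
      exact Prod.ext rfl (by ring)
  rcases L.region_cases r with ⟨h, rfl⟩ | ⟨u, rfl⟩
  · rcases L.region_cases s with ⟨h', rfl⟩ | ⟨u, rfl⟩
    · obtain ⟨c, i, j, hi, hj⟩ := hM _ _ (fun hne => hrs ((hleft h h').2 hne))
      obtain ⟨⟨c', k⟩, hk⟩ := e.surjective (c, 0)
      have hc (t) : e (c', k + t) = (c, t) := by rw [hrot, hk, zero_add]
      exact ⟨c', k + i, k + j, (hleft _ _).2 (by rw [hi, hc]), (hleft _ _).2 (by rw [hj, hc])⟩
    · exact isEmptyElim (d u).1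
  · exact isEmptyElim (d u).1

theorem torus_shareCrossing (n : ℕ) [NeZero n] (hn : n ≤ 3) (r s : (torus n).Region)
    (hrs : r ≠ s) : (torus n).ShareCrossing r s := by
  have hcases (r : (torus n).Region) : (∃ c : ZMod n, r = (torus n).left (c, (0 : ZMod 4)) ∧
      r = (torus n).left (c + 1, (2 : ZMod 4))) ∨
      (∀ c : ZMod n, r = (torus n).left (c, (1 : ZMod 4))) ∨
      ∀ c : ZMod n, r = (torus n).left (c, (3 : ZMod 4)) := by
    have h2 (c : ZMod n) :
        (torus n).left (c, (0 : ZMod 4)) = (torus n).left (c + 1, (2 : ZMod 4)) :=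
      Quotient.sound (congrArg inr (add_sub_cancel_right c 1).symm)
    rcases (torus n).region_cases r with ⟨⟨c, i⟩, rfl⟩ | ⟨⟨⟨⟩, -⟩, -⟩
    change ZMod n at c
    rcases zmod4_cases i with rfl | rfl | rfl | rfl
    · exact .inl ⟨c, rfl, h2 c⟩
    · exact .inr (.inl fun _ => Quotient.sound rfl)
    · exact .inl ⟨c - 1, Quotient.sound rfl,
        Quotient.sound (congrArg inr (add_sub_cancel_right (c - 1) 1).symm)⟩
    · exact .inr (.inr fun _ => Quotient.sound rfl)
  have hz (c d : ZMod n) : d = c ∨ d = c + 1 ∨ c = d + 1 := by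
    have h2 : ∀ c d : Fin 2, d = c ∨ d = c + 1 ∨ c = d + 1 := by decide
    have h3 : ∀ c d : Fin 3, d = c ∨ d = c + 1 ∨ c = d + 1 := by decide
    obtain rfl | rfl | rfl : n = 1 ∨ n = 2 ∨ n = 3 := by
      have := NeZero.ne n
      omega
    · exact .inl (Subsingleton.elim _ _)
    · exact h2 c d
    · exact h3 c d
  rcases hcases r with ⟨c, hc, hc'⟩ | hr | hr <;> rcases hcases s with ⟨d, hd, hd'⟩ | hs | hs
  · rcases hz c d with rfl | rfl | rfl
    · exact absurd (hc.trans hd.symm) hrs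
    · exact ⟨_, 2, 0, hc', hd⟩
    · exact ⟨_, 0, 2, hc, hd'⟩
  · exact ⟨_, 0, 1, hc, hs c⟩
  · exact ⟨_, 0, 3, hc, hs c⟩
  · exact ⟨_, 1, 0, hr d, hd⟩
  · exact absurd ((hr 0).trans (hs 0).symm) hrs
  · exact ⟨(0 : ZMod n), 1, 3, hr 0, hs 0⟩
  · exact ⟨_, 3, 0, hr d, hd⟩
  · exact ⟨(0 : ZMod n), 3, 1, hr 0, hs 0⟩
  · exact absurd ((hr 0).trans (hs 0).symm) hrs

theorem shareCrossing_of_same_torus (h : L.Same (torus 1) ∨ L.Same (torus 2) ∨ L.Same (torus 3))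
    (r s : L.Region) (hrs : r ≠ s) : L.ShareCrossing r s := by
  have (n : ℕ) [NeZero n] : IsEmpty (torus n).Circle := inferInstanceAs (IsEmpty Empty)
  rcases h with h | h | h
  · exact shareCrossing_of_same h (torus_shareCrossing 1 (by decide)) r s hrs
  · exact shareCrossing_of_same h (torus_shareCrossing 2 (by decide)) r s hrs
  · exact shareCrossing_of_same h (torus_shareCrossing 3 (by decide)) r s hrs

theorem isEmpty_crossing_of_same (h : L.Same trivialCircle) : IsEmpty L.Crossing := by
  obtain ⟨e, -⟩ := h
  exact ⟨fun c => (e (c, 0)).1.elim⟩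

theorem boundariesMeet_of_same (h : L.Same trivialCircle) (r s : L.Region) :
    L.BoundariesMeet r s := by
  have := isEmpty_crossing_of_same h
  obtain ⟨-, d, -, -, hd, -⟩ := h
  rcases L.region_cases r with ⟨h, rfl⟩ | ⟨⟨o, a⟩, rfl⟩
  · exact isEmptyElim h.1
  rcases L.region_cases s with ⟨h, rfl⟩ | ⟨⟨o', b⟩, rfl⟩
  · exact isEmptyElim h.1
  -- `d` sends the two sides of `o` to the only two sides of the trivial circle, so `(o', b)` is one
  -- of them.
  have ho : ∃ b', (o', b) = (o, b') := by
    have hu : ∀ x : trivialCircle.Circle, x = () := fun _ => rfl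
    by_cases hab : (d (o', b)).2 = (d (o, a)).2
    · exact ⟨a, d.injective (Prod.ext (by rw [hu (d (o', b)).1, hu (d (o, a)).1]) hab)⟩
    · refine ⟨!a, d.injective ((Prod.ext (by rw [hu (d (o', b)).1, hu (d (o, a)).1]) ?_ :
        d (o', b) = ((d (o, a)).1, !(d (o, a)).2)).trans (hd o a).symm)⟩
      exact Bool.eq_not_of_ne hab
  obtain ⟨b', hb'⟩ := ho
  obtain rfl := congrArg Prod.fst hb'
  exact .inr ⟨_, a, b, rfl, rfl⟩

theorem not_same_trivialCircle (hm : ∀ r s, r ≠ s → L.ShareCrossing r s) :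
    ¬ L.Same trivialCircle := by
  intro h
  have := isEmpty_crossing_of_same h
  obtain ⟨f, hf⟩ := L.exists_isCheckerboard
  obtain ⟨c | o⟩ := L.nonempty
  · exact isEmptyElim c
  · obtain ⟨c, -⟩ := hm _ _ (hf.side_ne o)
    exact isEmptyElim c

end

end LinkProjection

theorem theorem1 (L : LinkProjection) :
    (L.isolateRegionNumber' = 1 ↔
      L.Same LinkProjection.trivialCircle ∨ L.Same (LinkProjection.torus 1) ∨
        L.Same (LinkProjection.torus 2) ∨ L.Same (LinkProjection.torus 3)) ∧
    (L.isolateRegionNumber = 1 ↔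
      L.Same (LinkProjection.torus 1) ∨ L.Same (LinkProjection.torus 2) ∨
        L.Same (LinkProjection.torus 3)) := by
  rw [LinkProjection.isolateRegionNumber', LinkProjection.isolateRegionNumber,
    L.isolationNumber_eq_one_iff L.boundariesMeet_symm,
    L.isolationNumber_eq_one_iff L.shareCrossing_symm]
  refine ⟨⟨LinkProjection.classification, ?_⟩,
    ⟨fun h => ?_, LinkProjection.shareCrossing_of_same_torus⟩⟩
  · rintro (h | h) r s hrs
    · exact LinkProjection.boundariesMeet_of_same h r s
    · exact .inl (LinkProjection.shareCrossing_of_same_torus h r s hrs)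
  · exact (LinkProjection.classification fun r s hrs => .inl (h r s hrs)).resolve_left
      (LinkProjection.not_same_trivialCircle h)
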